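/- **Setting.** A bandit problem consists of a set of arms $\mathcal A$, a probability distribution on $\mathcal A$ (the reservoir distribution, the law of an arm picked at random from the reservoir), and for each arm $a$ a reward distribution $\nu_a$ supported on $[0,1]$, with mean $\mu_a$. The highest mean $\mu^*=\max_{a}\mu_a$ is attained, not all arms are optimal, and $\mu_{sub}=\sup\{\mu_a:\mu_a\neq\mu^*\}$ is the second highest mean. Write $\mathcal A^*=\{a:\mu_a=\mu^*\}$, and $p(\mathcal A^*)$ for the probability that an arm picked at random from the reservoir belongs to $\mathcal A^*$. For $\Delta>0$ and $p^*\in[0,1)$ let $\mathfrak B_{\Delta,p^*}$ be the set of bandit problems with $p(\mathcal A^*)\ge p^*$ and $|\mu^*-\mu_{sub}|\ge\Delta$. A bandit algorithm with budget $T$ plays in each of $T$ rounds either a new arm, drawn from the reservoir independently of everything before, or an arm drawn earlier, and receives a reward that is sampled from the distribution of that arm independently of everything else. Its choices depend only on its past choices, the past rewards and possibly exogenous randomness. After $T$ rounds it outputs an arm $\hat a_T$ (one drawn earlier, or a new one) on the basis of the same information. Its error is $e(T)=\mathbb P(\hat a_T\notin\mathcal A^*)$, the probability being over the arms drawn from the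 reservoir, the rewards and the exogenous randomness. **Theorem.** Let $\Delta\in(0,1/4)$, $p^*\in[0,1/4]$ and let $T\ge 0$ be an integer. For every bandit algorithm with budget $T$ there is a bandit problem in $\mathfrak B_{\Delta,p^*}$ on which $$e(T)\;\ge\;\frac14\exp\!\big(-32\,T\,p^*\Delta^2\big).$$ -/

import Mathlib

open MeasureTheory ProbabilityTheory

/-- A stochastic bandit problem with a reservoir of arms: a set of arms `Arm`, the law `reservoir`
of an arm picked at random, and for each arm `a` a reward distribution `reward a` on `[0, 1]`.
The highest mean is attained, and not every arm is optimal (so that the second highest mean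
exists). -/
structure BanditProblem where
  Arm : Type
  [measurableSpace : MeasurableSpace Arm]
  reservoir : Measure Arm
  [isProbabilityMeasure : IsProbabilityMeasure reservoir]
  reward : Kernel Arm ℝ
  [isMarkovKernel : IsMarkovKernel reward]
  reward_mem : ∀ a, ∀ᵐ y ∂(reward a), y ∈ Set.Icc (0 : ℝ) 1
  exists_best : ∃ a, ∀ b, ∫ y, y ∂(reward b) ≤ ∫ y, y ∂(reward a)
  exists_ne : ∃ a b, ∫ y, y ∂(reward a) ≠ ∫ y, y ∂(reward b)

attribute [instance] BanditProblem.measurableSpace BanditProblem.isProbabilityMeasure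
  BanditProblem.isMarkovKernel

/-- An observed history of `t` rounds: in each round, the label of the arm that was played and the
reward. Arms are labelled by natural numbers: the arms with labels `0, 1, 2, …` are independent
draws from the reservoir, so that playing a label for the first time is picking a new arm from the
reservoir. -/
abbrev History (t : ℕ) : Type := Fin t → ℕ × ℝ

/-- A (randomized) bandit algorithm with budget `T`: the conditional law of the label played
after a history of `t` rounds (used for `t < T`), and the conditional law of the label of the arm
that is output after `T` rounds. -/
structure BanditAlgorithm (T : ℕ) where
  play : (t : ℕ) → Kernel (History t) ℕ
  [isMarkovKernel_play : ∀ t, IsMarkovKernel (play t)]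
  output : Kernel (History T) ℕ
  [isMarkovKernel_output : IsMarkovKernel output]

attribute [instance] BanditAlgorithm.isMarkovKernel_play BanditAlgorithm.isMarkovKernel_output

namespace BanditProblem

variable (P : BanditProblem)

/-- The mean `μ_a` of an arm. -/
noncomputable def mean (a : P.Arm) : ℝ := ∫ y, y ∂(P.reward a)

/-- The highest mean `μ^*`. -/
noncomputable def bestMean : ℝ := ⨆ a, P.mean a

/-- The second highest mean `μ_sub`. -/
noncomputable def subMean : ℝ := sSup {m | ∃ a, P.mean a = m ∧ m ≠ P.bestMean}

/-- The set of optimal arms. -/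
def optimalArms : Set P.Arm := {a | P.mean a = P.bestMean}

/-- The proportion `p^*` of optimal arms in the reservoir. -/
noncomputable def optimalProportion : ℝ := P.reservoir.real P.optimalArms

/-- The arm with a given label, for a given sequence of arms drawn from the reservoir. -/
theorem measurable_armAt (t : ℕ) :
    Measurable fun x : ((ℕ → P.Arm) × History t) × ℕ => x.1.1 x.2 :=
  measurable_from_prod_countable_left fun j =>
    (measurable_pi_apply j).comp measurable_fst

variable {T : ℕ} (A : BanditAlgorithm T)

/-- One round: given the sequence of arms drawn from the reservoir and the history of `t` rounds,
the law of the next label (which depends on the history only) and of the reward (a fresh sample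
from the distribution of the arm with that label). -/
noncomputable def round (t : ℕ) : Kernel ((ℕ → P.Arm) × History t) (ℕ × ℝ) :=
  (A.play t).comap Prod.snd measurable_snd ⊗ₖ
    P.reward.comap (fun x => x.1.1 x.2) (P.measurable_armAt t)

/-- The law of the history of the first `t` rounds, given the sequence of arms drawn from the
reservoir. -/
noncomputable def historyLaw : (t : ℕ) → Kernel (ℕ → P.Arm) (History t)
  | 0 => Kernel.const _ (Measure.dirac Fin.elim0)
  | t + 1 => (historyLaw t ⊗ₖ P.round A t).map
      (fun x => (Fin.snoc x.1 x.2 : History (t + 1)))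

/-- The joint law of the sequence of arms drawn from the reservoir (independent and identically
distributed), the history of `T` rounds, and the label of the arm that is output. -/
noncomputable def law : Measure ((ℕ → P.Arm) × (History T × ℕ)) :=
  Measure.infinitePi (fun _ : ℕ => P.reservoir) ⊗ₘ
    (historyLaw P A T ⊗ₖ A.output.comap Prod.snd measurable_snd)

/-- The probability that the arm that is output is not optimal. -/
noncomputable def errorProb : ℝ :=
  (P.law A).real {x | x.1 x.2.2 ∉ P.optimalArms}

end BanditProblem

/-- The set of bandit problems whose proportion of optimal arms is at least `p` and whose gap
between the highest and the second highest mean is at least `Δ`. -/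
def banditClass (Δ p : ℝ) : Set BanditProblem :=
  {P | p ≤ P.optimalProportion ∧ Δ ≤ |P.bestMean - P.subMean|}

open scoped ENNReal

/-! The hard instance is Bernoulli: an arm has mean `1/2 + Δ` with probability `p`, and `1/2`
otherwise. Compare it with the model where every reward is a fair coin. There the history and the
output `k` are independent of the arm types, so the types can be averaged first
(`BanditProblem.lintegral_le_law_error`). Averaging is what produces the factor `p` in the exponent.

Fix the history and `k`. On the event that arm `k` is bad, the likelihood ratio is at least `exp W`,
where `W` sums `2Δs - 4Δ²` over the plays of good arms and `s = ±1` is the sign of the reward. A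
tangent line of `exp` replaces `exp W` by a linear function of `W`, whose average only involves the
plays of labels other than `k`. The omitted sum `S_k` of signs may be large, since `k` is chosen
after seeing the rewards, but `2ΔS_k ≤ 1 + Δ² ∑_j S_j²` for every `k`, and `∑_j S_j² - t` is a
martingale under fair coins. Integrating over histories (`BanditProblem.integral_energyMartingale`)
leaves `exp (-5pΔ²T - p) (1 - p)`. -/

/-! ### Integration over histories, one round at a time. -/

theorem measurable_history_snoc (t : ℕ) :
    Measurable fun x : History t × (ℕ × ℝ) => (Fin.snoc x.1 x.2 : History (t + 1)) := by
  refine measurable_pi_iff.2 fun i => ?_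
  refine Fin.lastCases ?_ (fun i => ?_) i
  · simpa using measurable_snd
  · simp only [Fin.snoc_castSucc]
    exact (measurable_pi_apply i).comp measurable_fst

namespace BanditProblem

variable (P : BanditProblem) {T : ℕ} (A : BanditAlgorithm T)

instance isMarkovKernel_round (t : ℕ) : IsMarkovKernel (P.round A t) := by
  unfold round
  infer_instance

instance isMarkovKernel_historyLaw (t : ℕ) : IsMarkovKernel (P.historyLaw A t) := by
  induction t with
  | zero => unfold historyLaw; infer_instance
  | succ t ih =>
    unfold historyLaw
    exact Kernel.IsMarkovKernel.map _ (measurable_history_snoc t)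

theorem lintegral_round (t : ℕ) (x : ℕ → P.Arm) (h : History t) {f : ℕ × ℝ → ℝ≥0∞}
    (hf : Measurable f) :
    ∫⁻ z, f z ∂(P.round A t (x, h)) =
      ∫⁻ j, ∫⁻ y, f (j, y) ∂(P.reward (x j)) ∂(A.play t h) := by
  unfold round
  rw [Kernel.lintegral_compProd _ _ _ hf]
  rfl

theorem lintegral_historyLaw_succ (t : ℕ) (x : ℕ → P.Arm) {f : History (t + 1) → ℝ≥0∞}
    (hf : Measurable f) :
    ∫⁻ h, f h ∂(P.historyLaw A (t + 1) x) =
      ∫⁻ h, ∫⁻ j, ∫⁻ y, f (Fin.snoc h (j, y)) ∂(P.reward (x j)) ∂(A.play t h)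
        ∂(P.historyLaw A t x) := by
  have hm := measurable_history_snoc t
  rw [historyLaw, Kernel.lintegral_map _ hm _ hf,
    Kernel.lintegral_compProd _ _ _ (f := fun z => f (Fin.snoc z.1 z.2)) (hf.comp hm)]
  refine lintegral_congr fun h => ?_
  exact lintegral_round P A t x h (f := fun z => f (Fin.snoc h z))
    (hf.comp (hm.comp measurable_prodMk_left))

theorem integral_historyLaw_succ (t : ℕ) (x : ℕ → P.Arm) {f : History (t + 1) → ℝ}
    (hf : Integrable f (P.historyLaw A (t + 1) x)) :
    ∫ h, f h ∂(P.historyLaw A (t + 1) x) =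
      ∫ h, ∫ z, f (Fin.snoc h z) ∂(P.round A t (x, h)) ∂(P.historyLaw A t x) := by
  have hm := measurable_history_snoc t
  rw [historyLaw, Kernel.map_apply _ hm] at hf ⊢
  rw [integral_map hm.aemeasurable hf.1]
  exact integral_compProd ((integrable_map_measure hf.1 hm.aemeasurable).1 hf)

theorem integral_round (t : ℕ) (x : ℕ → P.Arm) (h : History t) {f : ℕ × ℝ → ℝ}
    (hf : Integrable f (P.round A t (x, h))) :
    ∫ z, f z ∂(P.round A t (x, h)) =
      ∫ j, ∫ y, f (j, y) ∂(P.reward (x j)) ∂(A.play t h) := by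
  unfold round at hf ⊢
  rw [integral_compProd hf]
  rfl

/-- Change of measure for the history of a bandit: lower bounds `g` on the densities of the reward
distributions with respect to that of a reference arm multiply along the history. -/
theorem lintegral_historyLaw_const_le (a₀ : P.Arm) {g : P.Arm → ℝ → ℝ≥0∞}
    (hg : ∀ a, Measurable (g a))
    (hle : ∀ a (f : ℝ → ℝ≥0∞), Measurable f →
      ∫⁻ y, f y * g a y ∂(P.reward a₀) ≤ ∫⁻ y, f y ∂(P.reward a))
    (x : ℕ → P.Arm) (t : ℕ) {f : History t → ℝ≥0∞} (hf : Measurable f) :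
    ∫⁻ h, f h * ∏ i, g (x (h i).1) (h i).2 ∂(P.historyLaw A t fun _ => a₀) ≤
      ∫⁻ h, f h ∂(P.historyLaw A t x) := by
  have hgm : Measurable fun z : ℕ × ℝ => g (x z.1) z.2 :=
    measurable_from_prod_countable_right fun j => hg (x j)
  have hgt (t : ℕ) : Measurable fun h : History t => ∏ i, g (x (h i).1) (h i).2 :=
    Finset.measurable_prod _ fun i _ => hgm.comp (measurable_pi_apply i)
  induction t with
  | zero => simp [historyLaw]
  | succ t ih =>
    have hm := measurable_history_snoc t
    have hmeas : Measurable fun h : History t =>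
        ∫⁻ j, ∫⁻ y, f (Fin.snoc h (j, y)) ∂(P.reward (x j)) ∂(A.play t h) := by
      have h1 : Measurable fun h : History t => ∫⁻ z, f (Fin.snoc h z) ∂(P.round A t (x, h)) :=
        (hf.comp hm).lintegral_kernel_prod_right'
          (κ := (P.round A t).comap (fun h => (x, h)) measurable_prodMk_left)
      convert h1 using 2 with h
      exact (P.lintegral_round A t x h (f := fun z => f (Fin.snoc h z))
        (hf.comp (hm.comp measurable_prodMk_left))).symm
    rw [P.lintegral_historyLaw_succ A t _
        (f := fun h => f h * ∏ i, g (x (h i).1) (h i).2) (hf.mul (hgt _)),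
      P.lintegral_historyLaw_succ A t x hf]
    -- The induction hypothesis is applied to `f` with the last round integrated out under the arms
    -- `x`.
    refine le_trans (lintegral_mono fun h => ?_) (ih hmeas)
    have hfj (j : ℕ) : Measurable fun y : ℝ => f (Fin.snoc h (j, y)) :=
      hf.comp (hm.comp (measurable_prodMk_left.comp measurable_prodMk_left))
    dsimp only
    rw [← lintegral_mul_const _ (measurable_of_countable _)]
    refine lintegral_mono fun j => ?_
    dsimp only
    rw [← lintegral_mul_const _ (hfj j)]
    refine le_trans (le_of_eq ?_) (hle (x j) _ ((hfj j).mul_const _))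
    refine lintegral_congr fun y => ?_
    simp [Fin.prod_univ_castSucc, mul_assoc]

end BanditProblem

/-! ### Bernoulli rewards and the hard instance. -/

theorem Real.exp_sub_sq_le_one_add {x : ℝ} (hx : |x| ≤ 1 / 2) : Real.exp (x - x ^ 2) ≤ 1 + x := by
  obtain ⟨h1, h2⟩ := abs_le.1 hx
  have h : 1 ≤ Real.exp (-(x - x ^ 2)) * (1 + x) := by
    rcases le_total 0 x with h0 | h0
    -- The product equals `1 + x³`; for negative `x` this falls below `1`, hence the quadratic bound
    -- on `exp` in the other case.
    · calc (1 : ℝ) ≤ (-(x - x ^ 2) + 1) * (1 + x) := by nlinarith [pow_nonneg h0 3]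
        _ ≤ _ := by gcongr; exact Real.add_one_le_exp _
    · have hu : 0 ≤ -(x - x ^ 2) := by nlinarith
      calc (1 : ℝ) ≤ (1 + -(x - x ^ 2) + (-(x - x ^ 2)) ^ 2 / 2) * (1 + x) := by
            have h3 : 0 ≤ 1 + x - x ^ 2 + x ^ 3 := by nlinarith
            nlinarith [mul_nonneg (sq_nonneg x) h3]
        _ ≤ _ := by
          gcongr
          · linarith
          · exact Real.quadratic_le_exp_of_nonneg hu
  rw [Real.exp_neg] at h
  have := Real.exp_pos (x - x ^ 2)
  rwa [inv_mul_eq_div, one_le_div this] at h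

/-- The Bernoulli distribution with mean `m`, as a measure on the reals. -/
noncomputable def bernoulliReward (m : ℝ) : Measure ℝ :=
  ENNReal.ofReal (1 - m) • Measure.dirac 0 + ENNReal.ofReal m • Measure.dirac 1

theorem lintegral_bernoulliReward (m : ℝ) (f : ℝ → ℝ≥0∞) :
    ∫⁻ y, f y ∂(bernoulliReward m) = ENNReal.ofReal (1 - m) * f 0 + ENNReal.ofReal m * f 1 := by
  simp [bernoulliReward, lintegral_add_measure, lintegral_smul_measure]

theorem integral_bernoulliReward {m : ℝ} (hm : m ∈ Set.Icc (0 : ℝ) 1) (f : ℝ → ℝ) :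
    ∫ y, f y ∂(bernoulliReward m) = (1 - m) * f 0 + m * f 1 := by
  have h (a : ℝ) : Integrable f (Measure.dirac a) := integrable_dirac (by simp)
  rw [bernoulliReward, integral_add_measure ((h 0).smul_measure ENNReal.ofReal_ne_top)
    ((h 1).smul_measure ENNReal.ofReal_ne_top)]
  simp [integral_smul_measure, ENNReal.toReal_ofReal, hm.1, hm.2]

theorem isProbabilityMeasure_bernoulliReward {m : ℝ} (hm : m ∈ Set.Icc (0 : ℝ) 1) :
    IsProbabilityMeasure (bernoulliReward m) := by
  refine ⟨?_⟩
  rw [← lintegral_one, lintegral_bernoulliReward]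
  simp [← ENNReal.ofReal_add (sub_nonneg.2 hm.2) hm.1]

theorem ae_mem_Icc_bernoulliReward (m : ℝ) :
    ∀ᵐ y ∂(bernoulliReward m), y ∈ Set.Icc (0 : ℝ) 1 := by
  rw [bernoulliReward, ae_add_measure_iff]
  constructor <;> refine Measure.ae_smul_measure ?_ _ <;> simp [ae_dirac_eq]

/-- The mean of an arm of the problem with two types of arms. -/
noncomputable def twoTypeMean (Δ : ℝ) (b : Bool) : ℝ := if b then 1 / 2 + Δ else 1 / 2

/-- The law on the two types of arms for which the better type has probability `p`. -/
noncomputable def twoTypeReservoir (p : ℝ) : Measure Bool :=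
  ENNReal.ofReal (1 - p) • Measure.dirac false + ENNReal.ofReal p • Measure.dirac true

theorem isProbabilityMeasure_twoTypeReservoir {p : ℝ} (hp : p ∈ Set.Icc (0 : ℝ) 1) :
    IsProbabilityMeasure (twoTypeReservoir p) := by
  refine ⟨?_⟩
  simp [twoTypeReservoir, ← ENNReal.ofReal_add (sub_nonneg.2 hp.2) hp.1]

theorem twoTypeMean_mem_Icc {Δ : ℝ} (hΔ : Δ ∈ Set.Ioo (0 : ℝ) (1 / 2)) (b : Bool) :
    twoTypeMean Δ b ∈ Set.Icc (0 : ℝ) 1 := by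
  obtain ⟨h1, h2⟩ := hΔ
  unfold twoTypeMean
  split_ifs <;> constructor <;> linarith

theorem integral_bernoulliReward_twoTypeMean {Δ : ℝ} (hΔ : Δ ∈ Set.Ioo (0 : ℝ) (1 / 2)) (b : Bool) :
    ∫ y, y ∂(bernoulliReward (twoTypeMean Δ b)) = twoTypeMean Δ b := by
  simp [integral_bernoulliReward (twoTypeMean_mem_Icc hΔ b)]

/-- The bandit problem with Bernoulli rewards in which an arm picked at random has mean `1 / 2 + Δ`
with probability `p`, and mean `1 / 2` otherwise. -/
noncomputable def twoTypeProblem (Δ p : ℝ) (hΔ : Δ ∈ Set.Ioo (0 : ℝ) (1 / 2))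
    (hp : p ∈ Set.Icc (0 : ℝ) 1) : BanditProblem where
  Arm := Bool
  reservoir := twoTypeReservoir p
  isProbabilityMeasure := isProbabilityMeasure_twoTypeReservoir hp
  reward := Kernel.ofFunOfCountable fun b => bernoulliReward (twoTypeMean Δ b)
  isMarkovKernel := ⟨fun b => isProbabilityMeasure_bernoulliReward (twoTypeMean_mem_Icc hΔ b)⟩
  reward_mem b := ae_mem_Icc_bernoulliReward _
  exists_best := ⟨true, fun b => by
    have h := hΔ.1.le
    simp only [Kernel.ofFunOfCountable, Kernel.coe_mk,
      integral_bernoulliReward_twoTypeMean hΔ]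
    cases b <;> simp [twoTypeMean, h]⟩
  exists_ne := ⟨true, false, by
    have h := hΔ.1.ne'
    simp only [Kernel.ofFunOfCountable, Kernel.coe_mk,
      integral_bernoulliReward_twoTypeMean hΔ]
    simp [twoTypeMean, h]⟩

section TwoType

variable {Δ p : ℝ} (hΔ : Δ ∈ Set.Ioo (0 : ℝ) (1 / 2)) (hp : p ∈ Set.Icc (0 : ℝ) 1)

theorem twoTypeProblem_mean (b : Bool) :
    (twoTypeProblem Δ p hΔ hp).mean b = twoTypeMean Δ b :=
  integral_bernoulliReward_twoTypeMean hΔ b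

theorem twoTypeProblem_bestMean : (twoTypeProblem Δ p hΔ hp).bestMean = 1 / 2 + Δ := by
  have h := hΔ.1.le
  have : IsGreatest (Set.range (twoTypeProblem Δ p hΔ hp).mean) (1 / 2 + Δ) := by
    refine ⟨⟨true, by simp [twoTypeProblem_mean, twoTypeMean]⟩, ?_⟩
    rintro _ ⟨(b : Bool), rfl⟩
    rw [twoTypeProblem_mean hΔ hp b]
    cases b <;> simp [twoTypeMean, h]
  exact this.csSup_eq

theorem twoTypeProblem_subMean : (twoTypeProblem Δ p hΔ hp).subMean = 1 / 2 := by
  have h := hΔ.1.ne'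
  have : {m | ∃ a, (twoTypeProblem Δ p hΔ hp).mean a = m ∧
      m ≠ (twoTypeProblem Δ p hΔ hp).bestMean} = {1 / 2} := by
    ext m
    rw [twoTypeProblem_bestMean]
    constructor
    · rintro ⟨(b : Bool), rfl, hb⟩
      rw [twoTypeProblem_mean hΔ hp b] at hb ⊢
      cases b <;> simp_all [twoTypeMean]
    · rintro rfl
      exact ⟨false, by simp [twoTypeProblem_mean, twoTypeMean], by simp [h]⟩
  rw [BanditProblem.subMean, this, csSup_singleton]

theorem twoTypeProblem_mem_optimalArms (b : Bool) :
    b ∈ (twoTypeProblem Δ p hΔ hp).optimalArms ↔ b = true := by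
  have h := hΔ.1.ne'
  change (twoTypeProblem Δ p hΔ hp).mean b = (twoTypeProblem Δ p hΔ hp).bestMean ↔ _
  rw [twoTypeProblem_bestMean, twoTypeProblem_mean]
  cases b <;> simp [twoTypeMean, h]

theorem twoTypeReservoir_real_singleton (hp : p ∈ Set.Icc (0 : ℝ) 1) (b : Bool) :
    (twoTypeReservoir p).real {b} = if b then p else 1 - p := by
  cases b <;> simp [twoTypeReservoir, Measure.real, ENNReal.toReal_ofReal, hp.1, hp.2]

theorem twoTypeProblem_optimalProportion :
    (twoTypeProblem Δ p hΔ hp).optimalProportion = p := by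
  have : (twoTypeProblem Δ p hΔ hp).optimalArms = ({true} : Set Bool) :=
    Set.ext fun b => twoTypeProblem_mem_optimalArms hΔ hp b
  rw [BanditProblem.optimalProportion, this]
  exact (twoTypeReservoir_real_singleton hp true).trans (if_pos rfl)

theorem twoTypeProblem_mem_banditClass : twoTypeProblem Δ p hΔ hp ∈ banditClass Δ p := by
  refine ⟨(twoTypeProblem_optimalProportion hΔ hp).ge, ?_⟩
  rw [twoTypeProblem_bestMean, twoTypeProblem_subMean]
  simpa using le_abs_self Δ

end TwoType

/-! ### The energy of a history and its martingale. -/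

/-- The sign of a binary reward. -/
noncomputable def rewardSign (y : ℝ) : ℝ := if y = 1 then 1 else -1

theorem measurable_rewardSign : Measurable rewardSign :=
  Measurable.ite (measurableSet_singleton 1) measurable_const measurable_const

theorem rewardSign_mul_self (y : ℝ) : rewardSign y * rewardSign y = 1 := by
  unfold rewardSign; split_ifs <;> norm_num

theorem abs_rewardSign (y : ℝ) : |rewardSign y| = 1 := by
  unfold rewardSign; split_ifs <;> norm_num

/-- The sum of the signs of the rewards obtained from the arm with label `k`. -/
noncomputable def labelSum {t : ℕ} (h : History t) (k : ℕ) : ℝ :=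
  ∑ i, if (h i).1 = k then rewardSign (h i).2 else 0

/-- The sum over the labels `k` of the squares of `labelSum h k`. -/
noncomputable def labelEnergy {t : ℕ} (h : History t) : ℝ :=
  ∑ i, ∑ i', if (h i).1 = (h i').1 then rewardSign (h i).2 * rewardSign (h i').2 else 0

theorem labelEnergy_eq_sum_sq {t : ℕ} (h : History t) {J : Finset ℕ} (hJ : ∀ i, (h i).1 ∈ J) :
    labelEnergy h = ∑ j ∈ J, labelSum h j ^ 2 := by
  simp only [labelEnergy, labelSum, sq, Finset.sum_mul_sum]
  rw [Finset.sum_comm' (t' := Finset.univ) (s' := fun _ => J) (by simp)]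
  refine Finset.sum_congr rfl fun i _ => ?_
  rw [Finset.sum_comm]
  refine Finset.sum_congr rfl fun i' _ => ?_
  rw [Finset.sum_eq_single_of_mem _ (hJ i) (fun j _ hj => by simp [hj.symm])]
  by_cases hi : (h i).1 = (h i').1 <;> simp [hi, eq_comm]

/-- The bound is uniform in `k`, which is what allows the output label to depend on the history. -/
theorem sq_labelSum_le_labelEnergy {t : ℕ} (h : History t) (k : ℕ) :
    labelSum h k ^ 2 ≤ labelEnergy h := by
  -- Inserting `k` covers an output label that was never played.
  rw [labelEnergy_eq_sum_sq h (J := insert k (Finset.univ.image fun i => (h i).1)) (by simp)]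
  exact Finset.single_le_sum (f := fun j => labelSum h j ^ 2) (fun j _ => sq_nonneg _) (by simp)

theorem labelEnergy_snoc {t : ℕ} (h : History t) (j : ℕ) (y : ℝ) :
    labelEnergy (Fin.snoc h (j, y) : History (t + 1)) =
      labelEnergy h + 2 * labelSum h j * rewardSign y + 1 := by
  have e1 : ∑ i, (if j = (h i).1 then rewardSign y * rewardSign (h i).2 else 0) =
      labelSum h j * rewardSign y := by
    rw [labelSum, Finset.sum_mul]
    refine Finset.sum_congr rfl fun i _ => ?_
    simp only [eq_comm (a := j), ite_mul, zero_mul, mul_comm (rewardSign y)]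
  have e2 : ∑ i, (if (h i).1 = j then rewardSign (h i).2 * rewardSign y else 0) =
      labelSum h j * rewardSign y := by
    rw [labelSum, Finset.sum_mul]
    refine Finset.sum_congr rfl fun i _ => ?_
    by_cases hj : (h i).1 = j <;> simp [hj]
  simp only [labelEnergy, Fin.sum_univ_castSucc, Fin.snoc_castSucc, Fin.snoc_last,
    Finset.sum_add_distrib, if_true, rewardSign_mul_self, e1, e2]
  ring

/-- A martingale under fair coin rewards: the linear term minus the compensated energy. -/
noncomputable def energyMartingale (Δ : ℝ) {t : ℕ} (h : History t) : ℝ :=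
  2 * Δ * ∑ i, rewardSign (h i).2 + Δ ^ 2 * (t - labelEnergy h)

/-- The new sign has a coefficient determined by the past and the label played, so a sign of mean
zero makes the increment vanish on average. The `1` added to the energy is absorbed by the
compensator `t`. -/
theorem energyMartingale_snoc (Δ : ℝ) {t : ℕ} (h : History t) (j : ℕ) (y : ℝ) :
    energyMartingale Δ (Fin.snoc h (j, y) : History (t + 1)) =
      energyMartingale Δ h + 2 * (Δ - Δ ^ 2 * labelSum h j) * rewardSign y := by
  simp only [energyMartingale, labelEnergy_snoc, Fin.sum_univ_castSucc, Fin.snoc_castSucc,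
    Fin.snoc_last]
  push_cast
  ring

theorem measurable_label_eq {t : ℕ} (i i' : Fin t) :
    MeasurableSet {h : History t | (h i).1 = (h i').1} :=
  measurableSet_eq_fun (measurable_fst.comp (measurable_pi_apply i))
    (measurable_fst.comp (measurable_pi_apply i'))

theorem integrable_energyMartingale (Δ : ℝ) {t : ℕ} (μ : Measure (History t)) [IsFiniteMeasure μ] :
    Integrable (fun h : History t => energyMartingale Δ h) μ := by
  have hs (i : Fin t) : Measurable fun h : History t => rewardSign (h i).2 :=
    measurable_rewardSign.comp (measurable_snd.comp (measurable_pi_apply i))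
  refine Integrable.add (Integrable.const_mul (integrable_finsetSum _ fun i _ => ?_) _)
    (((integrable_const _).sub (integrable_finsetSum _ fun i _ =>
      integrable_finsetSum _ fun i' _ => ?_)).const_mul _)
  · refine Integrable.of_bound (hs i).aestronglyMeasurable 1 (ae_of_all _ fun h => ?_)
    simp [abs_rewardSign]
  · refine Integrable.of_bound (Measurable.ite (measurable_label_eq i i')
      ((hs i).mul (hs i')) measurable_const).aestronglyMeasurable 1 (ae_of_all _ fun h => ?_)
    split_ifs <;> simp [abs_rewardSign]

theorem BanditProblem.integral_energyMartingale (P : BanditProblem) {T : ℕ} (A : BanditAlgorithm T)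
    (Δ : ℝ) {x : ℕ → P.Arm} (hx : ∀ j, ∫ y, rewardSign y ∂(P.reward (x j)) = 0) (t : ℕ) :
    ∫ h, energyMartingale Δ h ∂(P.historyLaw A t x) = 0 := by
  induction t with
  | zero =>
    simp [BanditProblem.historyLaw, energyMartingale, labelEnergy]
  | succ t ih =>
    rw [P.integral_historyLaw_succ _ _ _ (integrable_energyMartingale Δ _), ← ih]
    refine integral_congr_ae (ae_of_all _ fun h => ?_)
    dsimp only
    have hm : Measurable fun z : ℕ × ℝ => (Fin.snoc h z : History (t + 1)) :=
      (measurable_history_snoc t).comp measurable_prodMk_left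
    rw [P.integral_round _ _ _ _ (f := fun z => energyMartingale Δ (Fin.snoc h z))
      ((integrable_energyMartingale Δ ((P.round A t (x, h)).map _)).comp_measurable hm)]
    have hi (j : ℕ) : Integrable rewardSign (P.reward (x j)) :=
      Integrable.of_bound measurable_rewardSign.aestronglyMeasurable 1
        (ae_of_all _ fun y => by simp [abs_rewardSign])
    have hy (j : ℕ) : ∫ y, energyMartingale Δ (Fin.snoc h (j, y) : History (t + 1))
        ∂(P.reward (x j)) = energyMartingale Δ h := by
      simp only [energyMartingale_snoc]
      rw [integral_add (integrable_const _) ((hi j).const_mul _), integral_const_mul, hx]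
      simp
    simp [hy]

/-! ### Change of measure and averaging over the arms. -/

theorem ofReal_integral_le_lintegral_ofReal {α : Type*} [MeasurableSpace α] {μ : Measure α}
    {f : α → ℝ} (hf : Integrable f μ) :
    ENNReal.ofReal (∫ x, f x ∂μ) ≤ ∫⁻ x, ENNReal.ofReal (f x) ∂μ := by
  refine ENNReal.ofReal_le_of_le_toReal ?_
  rw [integral_eq_lintegral_pos_part_sub_lintegral_neg_part hf]
  exact sub_le_self _ ENNReal.toReal_nonneg

open Classical in
/-- Lower bound on the error probability by a change of measure to a problem in which the rewards
do not depend on the arms, so that the arms can be averaged out first. -/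
theorem BanditProblem.lintegral_le_law_error (P : BanditProblem) {T : ℕ} (A : BanditAlgorithm T)
    (a₀ : P.Arm) {g : P.Arm → ℝ → ℝ≥0∞} (hg : Measurable (Function.uncurry g))
    (hle : ∀ a (f : ℝ → ℝ≥0∞), Measurable f →
      ∫⁻ y, f y * g a y ∂(P.reward a₀) ≤ ∫⁻ y, f y ∂(P.reward a))
    (hopt : MeasurableSet P.optimalArms) :
    ∫⁻ z, ∫⁻ x, (if x z.2 ∈ P.optimalArms then 0 else ∏ i, g (x (z.1 i).1) (z.1 i).2)
        ∂(Measure.infinitePi fun _ : ℕ => P.reservoir)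
        ∂((P.historyLaw A T fun _ => a₀) ⊗ₘ A.output) ≤
      P.law A {x | x.1 x.2.2 ∉ P.optimalArms} := by
  have harm : Measurable fun z : (ℕ → P.Arm) × ℕ => z.1 z.2 :=
    measurable_from_prod_countable_left fun j => measurable_pi_apply j
  have hgi (i : Fin T) : Measurable fun x : (ℕ → P.Arm) × (History T × ℕ) =>
      g (x.1 (x.2.1 i).1) (x.2.1 i).2 := by
    have hi : Measurable fun x : (ℕ → P.Arm) × (History T × ℕ) => x.2.1 i :=
      (measurable_pi_apply i).comp (measurable_fst.comp measurable_snd)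
    exact hg.comp ((harm.comp (measurable_fst.prodMk (measurable_fst.comp hi))).prodMk
      (measurable_snd.comp hi))
  have hE : MeasurableSet {x : (ℕ → P.Arm) × (History T × ℕ) | x.1 x.2.2 ∈ P.optimalArms} :=
    (harm.comp (measurable_fst.prodMk (measurable_snd.comp measurable_snd))) hopt
  have hS : MeasurableSet {x : (ℕ → P.Arm) × (History T × ℕ) | x.1 x.2.2 ∉ P.optimalArms} :=
    hE.compl
  have hF : Measurable fun x : (ℕ → P.Arm) × (History T × ℕ) =>
      if x.1 x.2.2 ∈ P.optimalArms then 0 else ∏ i, g (x.1 (x.2.1 i).1) (x.2.1 i).2 :=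
    Measurable.ite hE measurable_const
      (Finset.measurable_prod _ fun i _ => hgi i)
  -- Tonelli applies because the reference law of history and output does not depend on `x`.
  refine (lintegral_lintegral_swap (f := fun (x : ℕ → P.Arm) (z : History T × ℕ) =>
    if x z.2 ∈ P.optimalArms then 0 else ∏ i, g (x (z.1 i).1) (z.1 i).2)
      hF.aemeasurable).symm.trans_le ?_
  rw [BanditProblem.law, Measure.compProd_apply hS]
  refine lintegral_mono fun x => ?_
  have hK : MeasurableSet {k : ℕ | x k ∉ P.optimalArms} := MeasurableSet.of_discrete
  rw [Kernel.compProd_apply (measurable_prodMk_left hS),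
    Measure.lintegral_compProd (f := fun y : History T × ℕ =>
      if x y.2 ∈ P.optimalArms then 0 else ∏ i, g (x (y.1 i).1) (y.1 i).2)
      (hF.comp measurable_prodMk_left)]
  refine le_trans (le_of_eq ?_) (P.lintegral_historyLaw_const_le A a₀
    (fun a => hg.comp measurable_prodMk_left) hle x T (A.output.measurable_coe hK))
  refine lintegral_congr fun h => ?_
  change ∫⁻ k, (if x k ∈ P.optimalArms then 0 else ∏ i, g (x (h i).1) (h i).2) ∂(A.output h) =
    A.output h {k | x k ∉ P.optimalArms} * ∏ i, g (x (h i).1) (h i).2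
  rw [← lintegral_indicator_one hK, ← lintegral_mul_const _ (measurable_of_countable _)]
  refine lintegral_congr fun k => ?_
  by_cases hk : x k ∈ P.optimalArms <;> simp [hk]

instance BanditProblem.isProbabilityMeasure_law (P : BanditProblem) {T : ℕ}
    (A : BanditAlgorithm T) : IsProbabilityMeasure (P.law A) := by
  unfold BanditProblem.law
  infer_instance

/-- A lower bound on the log-likelihood ratio, at a reward `y`, between an arm of the type `b` and
an arm of the worse type. -/
noncomputable def logRatioBound (Δ : ℝ) (b : Bool) (y : ℝ) : ℝ :=
  if b then 2 * Δ * rewardSign y - (2 * Δ) ^ 2 else 0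

/-- For a good arm the likelihood ratios are `1 ± 2Δ`, and `exp (u - u²) ≤ 1 + u` at `u = ±2Δ` needs
`Δ ≤ 1/4`. -/
theorem lintegral_mul_exp_logRatioBound_le {Δ : ℝ} (hΔ : Δ ∈ Set.Icc (0 : ℝ) (1 / 4)) (b : Bool)
    (f : ℝ → ℝ≥0∞) :
    ∫⁻ y, f y * ENNReal.ofReal (Real.exp (logRatioBound Δ b y))
        ∂(bernoulliReward (twoTypeMean Δ false)) ≤
      ∫⁻ y, f y ∂(bernoulliReward (twoTypeMean Δ b)) := by
  obtain ⟨h0, h1⟩ := hΔ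
  have hpos := Real.exp_sub_sq_le_one_add (x := 2 * Δ) (abs_le.2 ⟨by linarith, by linarith⟩)
  have hneg := Real.exp_sub_sq_le_one_add (x := -(2 * Δ)) (abs_le.2 ⟨by linarith, by linarith⟩)
  rw [lintegral_bernoulliReward, lintegral_bernoulliReward]
  have key {m l m' : ℝ} (hm : 0 ≤ m) (h : m * Real.exp l ≤ m') (c : ℝ≥0∞) :
      ENNReal.ofReal m * (c * ENNReal.ofReal (Real.exp l)) ≤ ENNReal.ofReal m' * c := by
    rw [mul_left_comm, ← ENNReal.ofReal_mul hm, mul_comm c]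
    gcongr
  refine add_le_add (key ?_ ?_ _) (key ?_ ?_ _) <;> cases b <;>
    norm_num [twoTypeMean, logRatioBound, rewardSign] at hpos hneg ⊢
  · linarith
  · linarith

theorem infinitePi_twoTypeReservoir_real {p : ℝ} (hp : p ∈ Set.Icc (0 : ℝ) 1) (k j : ℕ) :
    haveI := isProbabilityMeasure_twoTypeReservoir hp
    (Measure.infinitePi fun _ : ℕ => twoTypeReservoir p).real {x | x k = false} = 1 - p ∧
    (Measure.infinitePi fun _ : ℕ => twoTypeReservoir p).real {x | x k = false ∧ x j = true} =
      if j = k then 0 else (1 - p) * p := by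
  have := isProbabilityMeasure_twoTypeReservoir hp
  have h1 : {x : ℕ → Bool | x k = false} = Set.pi (({k} : Finset ℕ) : Set ℕ) fun _ => {false} := by
    ext x; simp
  refine ⟨?_, ?_⟩
  · rw [h1, Measure.real, Measure.infinitePi_pi _ (fun _ _ => MeasurableSet.of_discrete)]
    rw [Finset.prod_singleton]
    exact twoTypeReservoir_real_singleton hp false
  · split_ifs with hjk
    · subst hjk
      have : {x : ℕ → Bool | x j = false ∧ x j = true} = ∅ := by
        ext x; simp +contextual
      rw [this, measureReal_empty]
    · have h2 : {x : ℕ → Bool | x k = false ∧ x j = true} =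
          Set.pi (({k, j} : Finset ℕ) : Set ℕ) fun i => {decide (i = j)} := by
        ext x; simp [Ne.symm hjk]
      rw [h2, Measure.real, Measure.infinitePi_pi _ (fun _ _ => MeasurableSet.of_discrete),
        Finset.prod_pair (Ne.symm hjk), ENNReal.toReal_mul]
      have e1 := twoTypeReservoir_real_singleton hp false
      have e2 := twoTypeReservoir_real_singleton hp true
      simp only [Measure.real] at e1 e2
      simp [Ne.symm hjk, e1, e2]

/-- The loss `5Δ²t` is `4Δ²t` from the quadratic terms plus `Δ²t` from the compensator of the
energy; the `1` comes from completing the square. -/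
theorem energyMartingale_le_sum {Δ : ℝ} {t : ℕ} (h : History t) (k : ℕ) :
    energyMartingale Δ h - 5 * Δ ^ 2 * t - 1 ≤
      ∑ i, if (h i).1 = k then 0 else 2 * Δ * rewardSign (h i).2 - (2 * Δ) ^ 2 := by
  have hsplit : ∑ i, (if (h i).1 = k then 0 else 2 * Δ * rewardSign (h i).2 - (2 * Δ) ^ 2) =
      2 * Δ * ∑ i, rewardSign (h i).2 - 2 * Δ * labelSum h k -
        ∑ i, if (h i).1 = k then 0 else (2 * Δ) ^ 2 := by
    rw [labelSum, Finset.mul_sum, Finset.mul_sum, ← Finset.sum_sub_distrib,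
      ← Finset.sum_sub_distrib]
    refine Finset.sum_congr rfl fun i _ => ?_
    split_ifs <;> ring
  have hcount : ∑ i, (if (h i).1 = k then 0 else (2 * Δ) ^ 2) ≤ t * (2 * Δ) ^ 2 := by
    refine (Finset.sum_le_card_nsmul _ _ ((2 * Δ) ^ 2) fun i _ => ?_).trans_eq (by simp)
    split_ifs
    · positivity
    · rfl
  have hsq := mul_le_mul_of_nonneg_left (sq_labelSum_le_labelEnergy h k) (sq_nonneg Δ)
  rw [hsplit, energyMartingale]
  nlinarith [sq_nonneg (Δ * labelSum h k - 1)]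

/-- Linearizing `exp` requires only the probabilities that `k` is bad and one other label is good,
so repeated plays of a label cause no trouble. The lower bound is affine in the martingale, ready to
be integrated. -/
theorem ofReal_le_lintegral_exp_logRatioBound {Δ p : ℝ} (hp : p ∈ Set.Icc (0 : ℝ) 1) {t : ℕ}
    (h : History t) (k : ℕ) :
    ENNReal.ofReal (Real.exp (-(5 * p * Δ ^ 2 * t) - p) * (1 - p) *
        (1 + p * energyMartingale Δ h)) ≤
      ∫⁻ x, (if x k = true then 0 else
          ∏ i, ENNReal.ofReal (Real.exp (logRatioBound Δ (x (h i).1) (h i).2)))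
        ∂(Measure.infinitePi fun _ : ℕ => twoTypeReservoir p) := by
  have := isProbabilityMeasure_twoTypeReservoir hp
  -- This tangent point makes `1 - c + p (M - 5Δ²t - 1)` equal to `1 + pM`, with `M` the martingale.
  set c : ℝ := -(5 * p * Δ ^ 2 * t) - p with hc
  set μ := Measure.infinitePi fun _ : ℕ => twoTypeReservoir p
  have hI : MeasurableSet {x : ℕ → Bool | x k = false} :=
    measurableSet_eq_fun (measurable_pi_apply k) measurable_const
  have hJ (j : ℕ) : MeasurableSet {x : ℕ → Bool | x k = false ∧ x j = true} :=
    hI.inter (measurableSet_eq_fun (measurable_pi_apply j) measurable_const)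
  have hiI : Integrable ({x : ℕ → Bool | x k = false}.indicator (1 : (ℕ → Bool) → ℝ)) μ :=
    (integrable_const (1 : ℝ)).indicator hI
  have hiJ (j : ℕ) :
      Integrable ({x : ℕ → Bool | x k = false ∧ x j = true}.indicator (1 : (ℕ → Bool) → ℝ)) μ :=
    (integrable_const (1 : ℝ)).indicator (hJ j)
  have hJval (j : ℕ) : μ.real {x | x k = false ∧ x j = true} = if j = k then 0 else (1 - p) * p :=
    (infinitePi_twoTypeReservoir_real hp k j).2
  have hisum : Integrable (fun x => ∑ i, (2 * Δ * rewardSign (h i).2 - (2 * Δ) ^ 2) *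
      {x : ℕ → Bool | x k = false ∧ x (h i).1 = true}.indicator (1 : (ℕ → Bool) → ℝ) x) μ :=
    integrable_finsetSum _ fun i _ => (hiJ _).const_mul _
  have hint : Integrable (fun x => Real.exp c * ((1 - c) *
      {x : ℕ → Bool | x k = false}.indicator (1 : (ℕ → Bool) → ℝ) x +
      ∑ i, (2 * Δ * rewardSign (h i).2 - (2 * Δ) ^ 2) *
        {x : ℕ → Bool | x k = false ∧ x (h i).1 = true}.indicator (1 : (ℕ → Bool) → ℝ) x)) μ :=
    ((hiI.const_mul _).add hisum).const_mul _
  refine le_trans (ENNReal.ofReal_le_ofReal ?_) ((ofReal_integral_le_lintegral_ofReal hint).trans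
    (lintegral_mono fun x => ?_))
  · rw [integral_const_mul, integral_add (hiI.const_mul _) hisum, integral_const_mul,
      integral_indicator_one hI, integral_finsetSum _ fun i _ => (hiJ _).const_mul _]
    simp only [integral_const_mul, integral_indicator_one (hJ _)]
    rw [(infinitePi_twoTypeReservoir_real hp k k).1]
    simp only [hJval]
    have hs : ∑ i, (2 * Δ * rewardSign (h i).2 - (2 * Δ) ^ 2) *
        (if (h i).1 = k then 0 else (1 - p) * p) =
        (1 - p) * p * ∑ i, if (h i).1 = k then 0 else
          2 * Δ * rewardSign (h i).2 - (2 * Δ) ^ 2 := by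
      rw [Finset.mul_sum]
      refine Finset.sum_congr rfl fun i _ => ?_
      split_ifs <;> ring
    rw [hs, mul_assoc]
    gcongr
    have hp' : 0 ≤ (1 - p) * p := mul_nonneg (sub_nonneg.2 hp.2) hp.1
    have := mul_le_mul_of_nonneg_left (energyMartingale_le_sum (Δ := Δ) h k) hp'
    rw [hc]
    linarith
  · dsimp only
    cases hk : x k
    · have hW : ∑ i, (2 * Δ * rewardSign (h i).2 - (2 * Δ) ^ 2) *
          {x : ℕ → Bool | x k = false ∧ x (h i).1 = true}.indicator (1 : (ℕ → Bool) → ℝ) x =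
          ∑ i, logRatioBound Δ (x (h i).1) (h i).2 := by
        refine Finset.sum_congr rfl fun i _ => ?_
        cases hx : x (h i).1 <;> simp [Set.indicator, hk, hx, logRatioBound]
      rw [hW, ← ENNReal.ofReal_prod_of_nonneg (fun _ _ => (Real.exp_pos _).le), ← Real.exp_sum]
      simp only [Set.indicator, Set.mem_ofPred_eq, hk, if_true, Pi.one_apply, mul_one,
        Bool.false_eq_true, if_false]
      refine ENNReal.ofReal_le_ofReal ?_
      set W := ∑ i, logRatioBound Δ (x (h i).1) (h i).2
      -- Tangent line of `exp` at `c`.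
      calc Real.exp c * (1 - c + W) ≤ Real.exp c * Real.exp (W - c) := by
            gcongr
            linarith [Real.add_one_le_exp (W - c)]
        _ = Real.exp W := by rw [← Real.exp_add]; congr 1; ring
    · simp [hk]

theorem measurable_exp_logRatioBound (Δ : ℝ) :
    Measurable (Function.uncurry fun (b : Bool) (y : ℝ) =>
      ENNReal.ofReal (Real.exp (logRatioBound Δ b y))) := by
  refine measurable_from_prod_countable_right fun b => ?_
  have := measurable_rewardSign
  cases b <;> simp only [Function.uncurry, logRatioBound, Bool.false_eq_true, if_true, if_false] <;>
    fun_prop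

/-! ### The error on the hard instance and the final constants. -/

/-- The error of an algorithm on the problem with two types of arms. -/
theorem exp_mul_le_errorProb_twoTypeProblem {Δ p : ℝ} (hΔ : Δ ∈ Set.Ioo (0 : ℝ) (1 / 2))
    (hΔ' : Δ ≤ 1 / 4) (hp : p ∈ Set.Icc (0 : ℝ) 1) {T : ℕ} (A : BanditAlgorithm T) :
    Real.exp (-(5 * p * Δ ^ 2 * T) - p) * (1 - p) ≤ (twoTypeProblem Δ p hΔ hp).errorProb A := by
  classical
  set P := twoTypeProblem Δ p hΔ hp
  set a₀ : P.Arm := (false : Bool)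
  have hlaw := P.lintegral_le_law_error A a₀
    (g := fun (b : Bool) (y : ℝ) => ENNReal.ofReal (Real.exp (logRatioBound Δ b y)))
    (measurable_exp_logRatioBound Δ)
    (fun b f _ => lintegral_mul_exp_logRatioBound_le ⟨hΔ.1.le, hΔ'⟩ b f)
    (MeasurableSet.of_discrete (α := Bool))
  have hsign (j : ℕ) : ∫ y, rewardSign y ∂(P.reward a₀) = 0 :=
    (integral_bernoulliReward (twoTypeMean_mem_Icc hΔ false) _).trans (by
      norm_num [twoTypeMean, rewardSign])
  have hint := integrable_energyMartingale Δ (P.historyLaw A T fun _ => a₀)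
  have hle : ENNReal.ofReal (Real.exp (-(5 * p * Δ ^ 2 * T) - p) * (1 - p)) ≤
      P.law A {x | x.1 x.2.2 ∉ P.optimalArms} := by
    set ν := (P.historyLaw A T fun _ => a₀) ⊗ₘ A.output
    have hmap : ν.map Prod.fst = P.historyLaw A T fun _ => a₀ := Measure.fst_compProd _ _
    have hF : Integrable (fun h : History T => Real.exp (-(5 * p * Δ ^ 2 * T) - p) * (1 - p) *
        (1 + p * energyMartingale Δ h)) (ν.map Prod.fst) :=
      ((integrable_const _).add
        ((integrable_energyMartingale Δ (ν.map Prod.fst)).const_mul _)).const_mul _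
    have hval : ∫ z, Real.exp (-(5 * p * Δ ^ 2 * T) - p) * (1 - p) *
        (1 + p * energyMartingale Δ z.1) ∂ν = Real.exp (-(5 * p * Δ ^ 2 * T) - p) * (1 - p) := by
      rw [← integral_map measurable_fst.aemeasurable hF.1, hmap, integral_const_mul,
        integral_add (integrable_const _) (hint.const_mul _), integral_const_mul,
        P.integral_energyMartingale A Δ hsign]
      simp
    rw [← hval]
    -- The affine bound may be negative for some histories, so its signed integral is compared with
    -- that of its positive part.
    refine (ofReal_integral_le_lintegral_ofReal (hF.comp_measurable measurable_fst)).trans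
      (le_trans (lintegral_mono fun z => ?_) hlaw)
    refine (ofReal_le_lintegral_exp_logRatioBound hp z.1 z.2).trans_eq ?_
    refine lintegral_congr fun x => ?_
    exact if_congr (twoTypeProblem_mem_optimalArms hΔ hp (x z.2)).symm rfl rfl
  exact (ENNReal.ofReal_le_iff_le_toReal (measure_ne_top _ _)).1 hle

theorem theorem5 (Δ p : ℝ) (hΔ : Δ ∈ Set.Ioo (0 : ℝ) (1 / 4)) (hp : p ∈ Set.Icc (0 : ℝ) (1 / 4))
    (T : ℕ) (A : BanditAlgorithm T) :
    ∃ P ∈ banditClass Δ p,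
      (1 / 4 : ℝ) * Real.exp (-(32 * (T : ℝ) * p * Δ ^ 2)) ≤ P.errorProb A := by
  have hΔ' : Δ ∈ Set.Ioo (0 : ℝ) (1 / 2) := ⟨hΔ.1, by linarith [hΔ.2]⟩
  have hp' : p ∈ Set.Icc (0 : ℝ) 1 := ⟨hp.1, by linarith [hp.2]⟩
  refine ⟨twoTypeProblem Δ p hΔ' hp', twoTypeProblem_mem_banditClass hΔ' hp',
    le_trans ?_ (exp_mul_le_errorProb_twoTypeProblem hΔ' hΔ.2.le hp' A)⟩
  have hp0 := hp.1
  have h1 : 3 / 4 ≤ Real.exp (-p) := by linarith [Real.add_one_le_exp (-p), hp.2]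
  -- There is slack: the product is at least `9/16`, and the exponent has `5` where `32` is allowed.
  have h2 : (1 / 4 : ℝ) ≤ Real.exp (-p) * (1 - p) := by nlinarith [hp.2]
  calc (1 / 4 : ℝ) * Real.exp (-(32 * (T : ℝ) * p * Δ ^ 2))
      ≤ (Real.exp (-p) * (1 - p)) * Real.exp (-(5 * p * Δ ^ 2 * T)) := by
        have : 0 ≤ p * Δ ^ 2 * T := by positivity
        refine mul_le_mul h2 (Real.exp_le_exp.2 ?_) (Real.exp_pos _).le
          (le_trans (by norm_num) h2)
        linarith
    _ = Real.exp (-(5 * p * Δ ^ 2 * T) - p) * (1 - p) := by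
        rw [sub_eq_neg_add (-(5 * p * Δ ^ 2 * T)), Real.exp_add]; ring
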